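/- Let $g_1,\dots,g_m,f\in\mathbb{R}[x]=\mathbb{R}[x_1,\dots,x_n]$, let $g_0:=1$ and $g_{m+i}:=1-x_i^2$ for $i=1,\dots,n$, and assume that $\mathbf{K}:=\{x\in\mathbb{R}^n : g_j(x)\ge 0,\ j=1,\dots,m+n\}$ contains $0$ and has nonempty interior. Let $d_0:=\deg f$ (with $\deg 0:=0$), let $d\in\mathbb{N}$ with $d_0\le 2d$, let $v_j:=\lceil(\deg g_j)/2\rceil$, and let $$Q_d(g):=\Big\{\sum_{j=0}^{m+n}\sigma_j g_j : \sigma_j\in\Sigma[x]_{d-v_j}\Big\},$$ where $\Sigma[x]_k$ is the set of sums of squares of polynomials having degree at most $2k$ (and $\Sigma[x]_k=\{0\}$ if $k<0$). Write $\|p\|_1$ for the sum of the absolute values of the coefficients of $p$. Fix $\epsilon>0$ and consider the inverse problem $$\rho^1_{d\epsilon}:=\min_{\tilde f}\big\{\|f-\tilde f\|_1 : \tilde f-\tilde f(0)+\epsilon\in Q_d(g),\ \deg\tilde f\le d_0\big\}\qquad(1)$$ and the semidefinite program $$\min_{b,\lambda\in\mathbb{R}^n}\Big\{\|b\|_1+\sum_{i=1}^n\lambda_i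 : f-f(0)+b'x+\sum_{i=1}^n\lambda_i x_i^2+\epsilon\in Q_d(g),\ \lambda\ge 0,\ \text{and } \lambda=0 \text{ if } d_0=1\Big\}.\qquad(2)$$ Then both minima are attained and they are equal. There is an optimal solution of (1) of the form $$\tilde f_{d\epsilon}(x)=f(x)+b'x+\sum_{i=1}^n\lambda_i^* x_i^2,$$ where $\lambda^*\ge 0$ (and $\lambda^*=0$ if $d_0=1$) and $(b,\lambda^*)$ is an optimal solution of (2). Moreover, for all $b\in\mathbb{R}^n$ and $\lambda\in\mathbb{R}^n$ with $\lambda\ge0$, the polynomial $f+b'x+\sum_i\lambda_i x_i^2$ is an optimal solution of (1) if and only if $(b,\lambda)$ is an optimal solution of (2). -/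

import Mathlib

namespace InversePoly

open MvPolynomial

noncomputable section

/-- `Σ[x]_k`: sums of squares of real polynomials, of degree at most `2k`.
For a negative integer `k` this is `{0}`. -/
def sosLE (n : ℕ) (k : ℤ) : Set (MvPolynomial (Fin n) ℝ) :=
  {p | IsSumSq p ∧ (p = 0 ∨ (p.totalDegree : ℤ) ≤ 2 * k)}

/-- `⌈(deg p) / 2⌉`. -/
def halfDeg {n : ℕ} (p : MvPolynomial (Fin n) ℝ) : ℕ := (p.totalDegree + 1) / 2

/-- The truncated quadratic module `Q_d(g)`: all `σ₀ + ∑ j, σ_j g_j` with `σ₀ ∈ Σ[x]_d` and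
`σ_j ∈ Σ[x]_{d - v_j}`, where `v_j = ⌈(deg g_j) / 2⌉`. -/
def truncModule {n : ℕ} {ι : Type} [Fintype ι] (g : ι → MvPolynomial (Fin n) ℝ) (d : ℕ) :
    Set (MvPolynomial (Fin n) ℝ) :=
  {p | ∃ σ₀ ∈ sosLE n d, ∃ σ : ι → MvPolynomial (Fin n) ℝ,
    (∀ j, σ j ∈ sosLE n ((d : ℤ) - halfDeg (g j))) ∧ p = σ₀ + ∑ j, σ j * g j}

/-- The basic semialgebraic set `{x | g_j x ≥ 0 for all j}`. -/
def feasibleSet {n : ℕ} {ι : Type} (g : ι → MvPolynomial (Fin n) ℝ) : Set (Fin n → ℝ) :=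
  {x | ∀ j, 0 ≤ eval x (g j)}

/-- The family `g_1, …, g_m` followed by the `n` box constraints `1 - x_i²`. -/
def withBox {n m : ℕ} (g : Fin m → MvPolynomial (Fin n) ℝ) :
    Fin m ⊕ Fin n → MvPolynomial (Fin n) ℝ :=
  Sum.elim g (fun i => 1 - X i ^ 2)

/-- The `ℓ₁`-norm of the coefficient vector. -/
def coeffNorm1 {n : ℕ} (p : MvPolynomial (Fin n) ℝ) : ℝ := ∑ α ∈ p.support, |p.coeff α|

/-- `h` is feasible for the inverse problem at the point `0` with tolerance `ε`: its degree is at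
most that of `f`, and `h - h(0) + ε` has a Putinar certificate with degree bound `d`. -/
def EpsFeasible {n : ℕ} {ι : Type} [Fintype ι] (g : ι → MvPolynomial (Fin n) ℝ)
    (f : MvPolynomial (Fin n) ℝ) (d : ℕ) (ε : ℝ) (h : MvPolynomial (Fin n) ℝ) : Prop :=
  h.totalDegree ≤ f.totalDegree ∧ h - C (eval 0 h) + C ε ∈ truncModule g d

/-- `h` is an optimal solution of: minimize `‖f - h‖₁` over the feasible `h`. -/
def EpsOptimal {n : ℕ} {ι : Type} [Fintype ι] (g : ι → MvPolynomial (Fin n) ℝ)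
    (f : MvPolynomial (Fin n) ℝ) (d : ℕ) (ε : ℝ) (h : MvPolynomial (Fin n) ℝ) : Prop :=
  EpsFeasible g f d ε h ∧
    ∀ p, EpsFeasible g f d ε p → coeffNorm1 (f - h) ≤ coeffNorm1 (f - p)

/-- `f + b'x + ∑ i, c_i x_i²`. -/
def canonicalForm {n : ℕ} (f : MvPolynomial (Fin n) ℝ) (b c : Fin n → ℝ) :
    MvPolynomial (Fin n) ℝ :=
  f + ∑ i, C (b i) * X i + ∑ i, C (c i) * X i ^ 2

/-- Feasibility of `(b, c)` for the canonical semidefinite program: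
`f - f(0) + b'x + ∑ i, c_i x_i² + ε ∈ Q_d(g)` and `c ≥ 0`, the quadratic terms being
absent (`c = 0`) if `deg f = 1`. -/
def SDPFeasible {n : ℕ} {ι : Type} [Fintype ι] (g : ι → MvPolynomial (Fin n) ℝ)
    (f : MvPolynomial (Fin n) ℝ) (d : ℕ) (ε : ℝ) (b c : Fin n → ℝ) : Prop :=
  f - C (eval 0 f) + ∑ i, C (b i) * X i + ∑ i, C (c i) * X i ^ 2 + C ε ∈ truncModule g d ∧
    (∀ i, 0 ≤ c i) ∧ (f.totalDegree = 1 → c = 0)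

/-- The objective `‖b‖₁ + ∑ i, c_i` of the canonical semidefinite program. -/
def sdpCost {n : ℕ} (b c : Fin n → ℝ) : ℝ := ∑ i, |b i| + ∑ i, c i

/-- `(b, c)` is an optimal solution of the canonical semidefinite program. -/
def SDPOptimal {n : ℕ} {ι : Type} [Fintype ι] (g : ι → MvPolynomial (Fin n) ℝ)
    (f : MvPolynomial (Fin n) ℝ) (d : ℕ) (ε : ℝ) (b c : Fin n → ℝ) : Prop :=
  SDPFeasible g f d ε b c ∧ ∀ b' c', SDPFeasible g f d ε b' c' → sdpCost b c ≤ sdpCost b' c'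

end

end InversePoly

/-! ### Closure properties of the truncated quadratic module. -/

namespace InversePoly

open MvPolynomial

variable {n : ℕ}

/-! Let `h` be feasible for (1) and `q = h - f`. The linear terms of `q` give `b`. Each term `q_α
x^α` of degree at least 2 is traded for squares: `Q_d(g)` contains `∑ w_i x_i² - q_α x^α` for some
`w ≥ 0` with `∑ w_i = |q_α|` (`exists_weights`). Adding these elements to the certificate of `h`
cancels the higher terms and leaves a feasible point of (2) costing at most `‖f - h‖₁`
(`EpsFeasible.exists_sdpFeasible`). The domination comes from the box constraints. Write `x^α = p q`
with nonconstant monomials of degree at most `d`. Then `(p ± q)²` bounds `∓2pq` by `p² + q²`, and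
telescoping with the multipliers of `1 - x_j²` bounds `p²` and `q²` by single squares `x_i²` and
`x_j²`. Conversely, a feasible point of (2) gives a polynomial `canonicalForm f b c` with `‖f -
canonicalForm f b c‖₁` equal to its cost, feasible for (1) unless `deg f = 0`; in that case `f`
itself is feasible and both minima are 0. Attainment for (2) holds because the cost is coercive and
`Q_d(g)` is closed. For closedness, multipliers are parametrized by Gram factors: the resulting map
is continuous, homogeneous of degree 2 and, since `K` has interior, vanishes only at 0
(`isClosed_range_of_homogeneous`, `gramSum_eq_zero`). Attainment for (1) follows by comparing costs.
-/

theorem sosLE_zero_mem (k : ℤ) : (0 : MvPolynomial (Fin n) ℝ) ∈ sosLE n k :=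
  ⟨IsSumSq.zero, Or.inl rfl⟩

theorem sosLE_add {k : ℤ} {p q : MvPolynomial (Fin n) ℝ} (hp : p ∈ sosLE n k)
    (hq : q ∈ sosLE n k) : p + q ∈ sosLE n k := by
  refine ⟨hp.1.add hq.1, ?_⟩
  rcases hp.2 with rfl | hp2
  · simpa using hq.2
  rcases hq.2 with rfl | hq2
  · simpa using Or.inr hp2
  right
  have := totalDegree_add p q
  rcases le_max_iff.1 this with h | h <;> omega

theorem sosLE_C_mul {k : ℤ} {p : MvPolynomial (Fin n) ℝ} (hp : p ∈ sosLE n k) {r : ℝ}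
    (hr : 0 ≤ r) : C r * p ∈ sosLE n k := by
  constructor
  · have : (C r : MvPolynomial (Fin n) ℝ) = C √r * C √r := by
      rw [← C_mul, Real.mul_self_sqrt hr]
    rw [this]
    exact (IsSumSq.mul_self _).mul hp.1
  · rcases hp.2 with rfl | hp2
    · simp
    right
    have := totalDegree_mul (C r) p
    rw [totalDegree_C] at this
    omega

theorem sq_mem_sosLE {k : ℤ} {p : MvPolynomial (Fin n) ℝ} (hp : (p.totalDegree : ℤ) ≤ k) :
    p ^ 2 ∈ sosLE n k := by
  refine ⟨by rw [sq]; exact IsSumSq.mul_self _, Or.inr ?_⟩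
  have := totalDegree_pow p 2
  omega

section TruncModule

variable {ι : Type} [Fintype ι] {g : ι → MvPolynomial (Fin n) ℝ} {d : ℕ}

theorem truncModule_add {p q : MvPolynomial (Fin n) ℝ} (hp : p ∈ truncModule g d)
    (hq : q ∈ truncModule g d) : p + q ∈ truncModule g d := by
  obtain ⟨s, hs, σ, hσ, rfl⟩ := hp
  obtain ⟨t, ht, τ, hτ, rfl⟩ := hq
  refine ⟨s + t, sosLE_add hs ht, σ + τ, fun j => sosLE_add (hσ j) (hτ j), ?_⟩
  simp only [Pi.add_apply, add_mul, Finset.sum_add_distrib]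
  ring

theorem truncModule_C_mul {p : MvPolynomial (Fin n) ℝ} (hp : p ∈ truncModule g d) {r : ℝ}
    (hr : 0 ≤ r) : C r * p ∈ truncModule g d := by
  obtain ⟨s, hs, σ, hσ, rfl⟩ := hp
  refine ⟨C r * s, sosLE_C_mul hs hr, fun j => C r * σ j, fun j => sosLE_C_mul (hσ j) hr, ?_⟩
  simp only [mul_add, Finset.mul_sum, mul_assoc]

theorem sosLE_subset_truncModule {p : MvPolynomial (Fin n) ℝ} (hp : p ∈ sosLE n d) :
    p ∈ truncModule g d :=
  ⟨p, hp, 0, fun _ => sosLE_zero_mem _, by simp⟩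

theorem truncModule_zero_mem : (0 : MvPolynomial (Fin n) ℝ) ∈ truncModule g d :=
  sosLE_subset_truncModule (sosLE_zero_mem _)

theorem C_mem_truncModule {r : ℝ} (hr : 0 ≤ r) :
    (C r : MvPolynomial (Fin n) ℝ) ∈ truncModule g d := by
  refine sosLE_subset_truncModule ?_
  have : (C r : MvPolynomial (Fin n) ℝ) = C r * 1 ^ 2 := by ring
  rw [this]
  exact sosLE_C_mul (sq_mem_sosLE (by simp)) hr

theorem truncModule_sum {κ : Type*} (s : Finset κ) {p : κ → MvPolynomial (Fin n) ℝ}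
    (hp : ∀ k ∈ s, p k ∈ truncModule g d) : ∑ k ∈ s, p k ∈ truncModule g d :=
  Finset.sum_induction p (· ∈ truncModule g d) (fun _ _ => truncModule_add)
    truncModule_zero_mem hp

theorem mul_mem_truncModule {j : ι} {p : MvPolynomial (Fin n) ℝ}
    (hp : p ∈ sosLE n ((d : ℤ) - halfDeg (g j))) : p * g j ∈ truncModule g d := by
  classical
  refine ⟨0, sosLE_zero_mem _, Pi.single j p, fun i => ?_, ?_⟩
  · by_cases h : i = j
    · subst h; simpa using hp
    · simpa [h] using sosLE_zero_mem _
  · rw [Finset.sum_eq_single j] <;> simp +contextual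

end TruncModule

/-! ### Domination of monomials by the squares `x_i²` through the box constraints. -/

section Box

variable {m : ℕ} {g : Fin m → MvPolynomial (Fin n) ℝ} {d : ℕ}

theorem halfDeg_one_sub_X_sq_le (i : Fin n) :
    halfDeg (1 - X i ^ 2 : MvPolynomial (Fin n) ℝ) ≤ 1 := by
  have h := totalDegree_sub (1 : MvPolynomial (Fin n) ℝ) (X i ^ 2)
  simp only [totalDegree_one, totalDegree_X_pow] at h
  simp only [halfDeg]
  omega

theorem sosLE_mono {k l : ℤ} (h : k ≤ l) : sosLE n k ⊆ sosLE n l :=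
  fun _ hp => ⟨hp.1, hp.2.imp id fun h' => by omega⟩

theorem mul_box_mem {i : Fin n} {p : MvPolynomial (Fin n) ℝ} (hp : p ∈ sosLE n ((d : ℤ) - 1)) :
    p * (1 - X i ^ 2) ∈ truncModule (withBox g) d := by
  refine mul_mem_truncModule (g := withBox g) (j := Sum.inr i) (sosLE_mono ?_ hp)
  have := halfDeg_one_sub_X_sq_le i
  simp only [withBox, Sum.elim_inr]
  omega

/-- The monomial attached to a list of variables. -/
noncomputable def listMonomial (l : List (Fin n)) : MvPolynomial (Fin n) ℝ := (l.map X).prod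

theorem listMonomial_cons (i : Fin n) (l : List (Fin n)) :
    listMonomial (i :: l) = X i * listMonomial l := by
  simp [listMonomial]

theorem listMonomial_append (l l' : List (Fin n)) :
    listMonomial (l ++ l') = listMonomial l * listMonomial l' := by
  simp [listMonomial]

theorem totalDegree_listMonomial_le (l : List (Fin n)) :
    (listMonomial l).totalDegree ≤ l.length := by
  induction l with
  | nil => simp [listMonomial]
  | cons i l ih =>
    rw [listMonomial_cons, List.length_cons]
    have := totalDegree_mul (X i) (listMonomial l)
    rw [totalDegree_X] at this
    omega

theorem monomial_eq_listMonomial (α : Fin n →₀ ℕ) :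
    monomial α (1 : ℝ) = listMonomial (Finsupp.toMultiset α).toList := by
  rw [listMonomial, ← Multiset.prod_coe, ← Multiset.map_coe, Multiset.coe_toList,
    Finsupp.toMultiset_map, Finsupp.prod_toMultiset, monomial_eq, C_1, one_mul,
    Finsupp.prod_mapDomain_index] <;> simp [pow_add]

/-- Telescoping: appending a variable `x_j` to a monomial `u` changes `-u²` by `u² (1 - x_j²)`,
where `u` has degree at most `d - 1`, as the multiplier of a box constraint requires. -/
theorem X_sq_mul_one_sub_mem (i : Fin n) (l : List (Fin n)) (hl : l.length + 1 ≤ d) :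
    X i ^ 2 - (X i * listMonomial l) ^ 2 ∈ truncModule (withBox g) d := by
  induction l with
  | nil => simpa [listMonomial] using truncModule_zero_mem
  | cons j l ih =>
    rw [List.length_cons] at hl
    have h : (X i * listMonomial l) ^ 2 * (1 - X j ^ 2) ∈ truncModule (withBox g) d := by
      refine mul_box_mem (sq_mem_sosLE ?_)
      have h1 := totalDegree_mul (X i) (listMonomial l)
      have h2 := totalDegree_listMonomial_le l
      rw [totalDegree_X] at h1
      omega
    convert truncModule_add (ih (by omega)) h using 1
    rw [listMonomial_cons]
    ring

theorem X_sq_sub_listMonomial_sq_mem {l : List (Fin n)} (hl : l ≠ []) (hd : l.length ≤ d) :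
    ∃ i, X i ^ 2 - listMonomial l ^ 2 ∈ truncModule (withBox g) d := by
  cases l with
  | nil => exact absurd rfl hl
  | cons i l =>
    refine ⟨i, ?_⟩
    rw [listMonomial_cons]
    exact X_sq_mul_one_sub_mem i l (by simpa using hd)

/-- A term of degree between `2` and `2d` is dominated, modulo the truncated quadratic module, by
an average of the squares `x_i²`. -/
theorem exists_weights (α : Fin n →₀ ℕ) (h2 : 2 ≤ α.degree) (hα : α.degree ≤ 2 * d) (t : ℝ) :
    ∃ w : Fin n → ℝ, (∀ i, 0 ≤ w i) ∧ ∑ i, w i = |t| ∧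
      ∑ i, C (w i) * X i ^ 2 + monomial α t ∈ truncModule (withBox g) d := by
  classical
  set l := (Finsupp.toMultiset α).toList with hl
  have hlen : l.length = α.degree := by
    rw [hl, Multiset.length_toList, Finsupp.card_toMultiset]
    rfl
  -- Cutting the list of variables in the middle gives two halves that are nonempty because the
  -- degree is at least 2, and of length at most `d` because it is at most `2d`.
  obtain ⟨i, hi⟩ := X_sq_sub_listMonomial_sq_mem (g := g) (d := d) (l := l.take (l.length / 2))
    (by rw [← List.length_pos_iff, List.length_take]; omega) (by rw [List.length_take]; omega)
  obtain ⟨j, hj⟩ := X_sq_sub_listMonomial_sq_mem (g := g) (d := d) (l := l.drop (l.length / 2))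
    (by rw [← List.length_pos_iff, List.length_drop]; omega) (by rw [List.length_drop]; omega)
  have hdeg1 := totalDegree_listMonomial_le (l.take (l.length / 2))
  have hdeg2 := totalDegree_listMonomial_le (l.drop (l.length / 2))
  have hmon : monomial α t = C t *
      (listMonomial (l.take (l.length / 2)) * listMonomial (l.drop (l.length / 2))) := by
    rw [← listMonomial_append, List.take_append_drop, ← monomial_eq_listMonomial, C_mul_monomial,
      mul_one]
  rw [List.length_take] at hdeg1
  rw [List.length_drop] at hdeg2
  generalize listMonomial (l.take (l.length / 2)) = p at *
  generalize listMonomial (l.drop (l.length / 2)) = q at *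
  -- The sign of `t`, but never 0, so that `s² = 1` holds for `t = 0` too.
  obtain ⟨s, hs1, hs2⟩ : ∃ s : ℝ, s * s = 1 ∧ |t| * s = t := by
    rcases le_total 0 t with h | h
    · exact ⟨1, by simp, by simp [abs_of_nonneg h]⟩
    · exact ⟨-1, by simp, by simp [abs_of_nonpos h]⟩
  have hsq : (p + C s * q) ^ 2 ∈ truncModule (withBox g) d := by
    refine sosLE_subset_truncModule (sq_mem_sosLE ?_)
    have h1 := totalDegree_add p (C s * q)
    have h2 := totalDegree_mul (C s) q
    rw [totalDegree_C] at h2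
    rcases le_max_iff.1 h1 with h | h <;> omega
  refine ⟨Pi.single i (|t| / 2) + Pi.single j (|t| / 2), fun k => ?_, ?_, ?_⟩
  · simp only [Pi.add_apply, Pi.single_apply]
    split_ifs <;> positivity
  · simp [Finset.sum_add_distrib]
  -- The certificate is `|t|/2 · ((x_i² - p²) + (x_j² - q²) + (p + s q)²)`; the squares of `p` and
  -- `q` cancel and the cross term is `|t| s p q = t x^α`.
  · convert truncModule_C_mul (truncModule_add (truncModule_add hi hj) hsq)
      (r := |t| / 2) (by positivity) using 1
    have e : ∀ k : Fin n, ∑ i, C (Pi.single (M := fun _ => ℝ) k (|t| / 2) i) *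
        (X i : MvPolynomial (Fin n) ℝ) ^ 2 = C (|t| / 2) * X k ^ 2 := fun k => by
      rw [Finset.sum_eq_single k] <;> simp +contextual
    simp only [Pi.add_apply, C_add, add_mul, Finset.sum_add_distrib, e]
    have e1 : (C s * C s : MvPolynomial (Fin n) ℝ) = 1 := by rw [← C_mul, hs1, C_1]
    have e2 : (C t : MvPolynomial (Fin n) ℝ) = C (|t| / 2) * C s + C (|t| / 2) * C s := by
      rw [← C_mul, ← C_add]
      congr 1
      linear_combination -hs2
    rw [hmon, e2]
    linear_combination (-(C (|t| / 2)) * q ^ 2) * e1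

end Box

end InversePoly

/-! ### The `ℓ₁`-norm and the passage between problems (1) and (2). -/

namespace InversePoly

open MvPolynomial

variable {n : ℕ}

theorem coeffNorm1_eq_sum {p : MvPolynomial (Fin n) ℝ} {s : Finset (Fin n →₀ ℕ)}
    (hs : p.support ⊆ s) : coeffNorm1 p = ∑ α ∈ s, |p.coeff α| :=
  Finset.sum_subset hs fun α _ h => by simp [notMem_support_iff.1 h]

theorem sum_abs_coeff_le_coeffNorm1 (p : MvPolynomial (Fin n) ℝ) (s : Finset (Fin n →₀ ℕ)) :
    ∑ α ∈ s, |p.coeff α| ≤ coeffNorm1 p := by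
  classical
  rw [coeffNorm1_eq_sum (Finset.subset_union_left (s₂ := s))]
  exact Finset.sum_le_sum_of_subset_of_nonneg Finset.subset_union_right
    fun _ _ _ => abs_nonneg _

theorem coeff_sum_C_mul_X (b : Fin n → ℝ) (α : Fin n →₀ ℕ) :
    coeff α (∑ i, C (b i) * X i) = ∑ i, if Finsupp.single i 1 = α then b i else 0 := by
  simp [coeff_sum, coeff_C_mul, coeff_X, mul_ite]

theorem coeff_sum_C_mul_X_sq (c : Fin n → ℝ) (α : Fin n →₀ ℕ) :
    coeff α (∑ i, C (c i) * X i ^ 2) = ∑ i, if Finsupp.single i 2 = α then c i else 0 := by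
  simp [coeff_sum, coeff_C_mul, coeff_X_pow, mul_ite]

/-- The exponents of the monomials `x_i` and `x_i²`. -/
noncomputable def pureExponent : Fin n ⊕ Fin n ↪ (Fin n →₀ ℕ) where
  toFun := Sum.elim (fun i => Finsupp.single i 1) (fun i => Finsupp.single i 2)
  inj' := by
    rintro (i | i) (j | j) h <;> simp [Finsupp.single_eq_single_iff] at h ⊢ <;> exact h

theorem coeff_correction (b c : Fin n → ℝ) (s : Fin n ⊕ Fin n) :
    coeff (pureExponent s) (∑ i, C (b i) * X i + ∑ i, C (c i) * X i ^ 2) =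
      Sum.elim b c s := by
  rw [coeff_add, coeff_sum_C_mul_X, coeff_sum_C_mul_X_sq]
  rcases s with i | i
  · rw [show pureExponent (Sum.inl i) = Finsupp.single i 1 from rfl]
    simp [Finsupp.single_eq_single_iff]
  · rw [show pureExponent (Sum.inr i) = Finsupp.single i 2 from rfl]
    simp [Finsupp.single_eq_single_iff]

/-- The exponents of the `x_i` and `x_i²` are pairwise distinct, so no coefficients merge and the
norm is additive. -/
theorem coeffNorm1_sub_canonicalForm (f : MvPolynomial (Fin n) ℝ) (b c : Fin n → ℝ) :
    coeffNorm1 (f - canonicalForm f b c) = ∑ i, |b i| + ∑ i, |c i| := by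
  classical
  have e : f - canonicalForm f b c =
      -(∑ i, C (b i) * X i + ∑ i, C (c i) * X i ^ 2) := by
    rw [canonicalForm]; ring
  rw [e, coeffNorm1_eq_sum (s := Finset.univ.map pureExponent)]
  · rw [Finset.sum_map, Fintype.sum_sum_type]
    simp only [coeff_neg, coeff_correction, abs_neg, Sum.elim_inl, Sum.elim_inr]
  · intro α hα
    rw [mem_support_iff, coeff_neg, neg_ne_zero, coeff_add, coeff_sum_C_mul_X,
      coeff_sum_C_mul_X_sq] at hα
    by_contra h
    apply hα
    have h' : ∀ s, pureExponent s ≠ α := fun s hs => h (by simp [← hs])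
    have h1 : ∀ i : Fin n, Finsupp.single i 1 ≠ α := fun i => h' (Sum.inl i)
    have h2 : ∀ i : Fin n, Finsupp.single i 2 ≠ α := fun i => h' (Sum.inr i)
    simp [h1, h2]

theorem coeffNorm1_sub_canonicalForm_of_nonneg (f : MvPolynomial (Fin n) ℝ) (b : Fin n → ℝ)
    {c : Fin n → ℝ} (hc : ∀ i, 0 ≤ c i) :
    coeffNorm1 (f - canonicalForm f b c) = sdpCost b c := by
  rw [coeffNorm1_sub_canonicalForm, sdpCost]
  simp only [abs_of_nonneg (hc _)]

theorem sdpCost_nonneg (b : Fin n → ℝ) {c : Fin n → ℝ} (hc : ∀ i, 0 ≤ c i) :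
    0 ≤ sdpCost b c :=
  add_nonneg (Finset.sum_nonneg fun _ _ => abs_nonneg _) (Finset.sum_nonneg fun i _ => hc i)

theorem eq_zero_of_sdpCost_nonpos {b c : Fin n → ℝ} (hc : ∀ i, 0 ≤ c i)
    (h : sdpCost b c ≤ 0) : b = 0 ∧ c = 0 := by
  have hb : 0 ≤ ∑ i, |b i| := Finset.sum_nonneg fun _ _ => abs_nonneg _
  have hc' : 0 ≤ ∑ i, c i := Finset.sum_nonneg fun i _ => hc i
  rw [sdpCost] at h
  have h1 := (Finset.sum_eq_zero_iff_of_nonneg fun i _ => abs_nonneg (b i)).1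
    (le_antisymm (by linarith) hb)
  have h2 := (Finset.sum_eq_zero_iff_of_nonneg fun i _ => hc i).1
    (le_antisymm (by linarith) hc')
  exact ⟨funext fun i => abs_eq_zero.1 (h1 i (Finset.mem_univ i)),
    funext fun i => h2 i (Finset.mem_univ i)⟩

theorem canonicalForm_zero (f : MvPolynomial (Fin n) ℝ) : canonicalForm f 0 0 = f := by
  simp [canonicalForm]

theorem canonicalForm_sub_C_eval (f : MvPolynomial (Fin n) ℝ) (b c : Fin n → ℝ) (ε : ℝ) :
    canonicalForm f b c - C (eval 0 (canonicalForm f b c)) + C ε =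
      f - C (eval 0 f) + ∑ i, C (b i) * X i + ∑ i, C (c i) * X i ^ 2 + C ε := by
  have : eval 0 (canonicalForm f b c) = eval 0 f := by simp [canonicalForm]
  rw [this, canonicalForm]
  ring

theorem totalDegree_canonicalForm_le {f : MvPolynomial (Fin n) ℝ} (b : Fin n → ℝ)
    {c : Fin n → ℝ} (h0 : f.totalDegree ≠ 0) (hc : f.totalDegree = 1 → c = 0) :
    (canonicalForm f b c).totalDegree ≤ f.totalDegree := by
  have h1 : (∑ i, C (b i) * X i : MvPolynomial (Fin n) ℝ).totalDegree ≤ 1 :=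
    totalDegree_finsetSum_le fun i _ => by
      have := totalDegree_mul (C (b i)) (X i : MvPolynomial (Fin n) ℝ)
      rw [totalDegree_C, totalDegree_X] at this
      omega
  have h2 : (∑ i, C (c i) * X i ^ 2 : MvPolynomial (Fin n) ℝ).totalDegree ≤ f.totalDegree := by
    by_cases h : f.totalDegree = 1
    · simp [hc h]
    · refine totalDegree_finsetSum_le fun i _ => ?_
      have := totalDegree_mul (C (c i)) (X i ^ 2 : MvPolynomial (Fin n) ℝ)
      rw [totalDegree_C, totalDegree_X_pow] at this
      omega
  rw [canonicalForm]
  refine (totalDegree_add _ _).trans (max_le ((totalDegree_add _ _).trans ?_) h2)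
  exact max_le le_rfl (by omega)

section

variable {ι : Type} [Fintype ι] {g : ι → MvPolynomial (Fin n) ℝ}
  {f : MvPolynomial (Fin n) ℝ} {d : ℕ} {ε : ℝ} {b c : Fin n → ℝ}

/-- The clause on `deg f = 1` follows from the degree bound in (1): the coefficient of `x_i²` in the
canonical form is then both 0 and `c i`. -/
theorem EpsFeasible.sdpFeasible (h : EpsFeasible g f d ε (canonicalForm f b c))
    (hc : ∀ i, 0 ≤ c i) : SDPFeasible g f d ε b c := by
  refine ⟨by rw [← canonicalForm_sub_C_eval]; exact h.2, hc, fun h1 => funext fun i => ?_⟩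
  have h2 : coeff (Finsupp.single i 2) (canonicalForm f b c) = 0 :=
    coeff_eq_zero_of_totalDegree_lt (by
      rw [← Finsupp.degree_apply, Finsupp.degree_single]
      exact lt_of_le_of_lt h.1 (by omega))
  have h3 : coeff (Finsupp.single i 2) f = 0 :=
    coeff_eq_zero_of_totalDegree_lt (by
      rw [← Finsupp.degree_apply, Finsupp.degree_single]
      omega)
  have h4 := coeff_correction b c (Sum.inr i)
  rw [canonicalForm, add_assoc, coeff_add, h3, zero_add] at h2
  exact h4.symm.trans h2

theorem SDPFeasible.epsFeasible (h : SDPFeasible g f d ε b c) (h0 : f.totalDegree ≠ 0) :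
    EpsFeasible g f d ε (canonicalForm f b c) :=
  ⟨totalDegree_canonicalForm_le b h0 h.2.2, by rw [canonicalForm_sub_C_eval]; exact h.1⟩

theorem epsFeasible_of_totalDegree_eq_zero (h0 : f.totalDegree = 0) (hε : 0 ≤ ε) :
    EpsFeasible g f d ε f := by
  refine ⟨le_rfl, ?_⟩
  rw [totalDegree_eq_zero_iff_eq_C.1 h0]
  simpa using C_mem_truncModule hε

/-- For constant `f`, program (2) still allows nonzero `b` and `c`, whose canonical form breaks the
degree bound of (1). The competitor is then `f`, at cost 0. -/
theorem SDPFeasible.exists_epsFeasible (h : SDPFeasible g f d ε b c) (hε : 0 ≤ ε) :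
    ∃ p, EpsFeasible g f d ε p ∧ coeffNorm1 (f - p) ≤ sdpCost b c := by
  by_cases h0 : f.totalDegree = 0
  · exact ⟨f, epsFeasible_of_totalDegree_eq_zero h0 hε,
      by simpa [coeffNorm1] using sdpCost_nonneg b h.2.1⟩
  · exact ⟨_, h.epsFeasible h0, (coeffNorm1_sub_canonicalForm_of_nonneg f b h.2.1).le⟩

/-- For constant `f` the point `(0, 0)` is feasible at cost 0, so optimality forces `b = c = 0` and
the degree bound survives. -/
theorem SDPOptimal.epsFeasible (h : SDPOptimal g f d ε b c) (hε : 0 ≤ ε) :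
    EpsFeasible g f d ε (canonicalForm f b c) := by
  by_cases h0 : f.totalDegree = 0
  · have hf := epsFeasible_of_totalDegree_eq_zero (g := g) (d := d) h0 hε
    have hz : SDPFeasible g f d ε 0 0 :=
      EpsFeasible.sdpFeasible (by rwa [canonicalForm_zero]) fun _ => le_rfl
    obtain ⟨rfl, rfl⟩ := eq_zero_of_sdpCost_nonpos h.1.2.1 ((h.2 0 0 hz).trans
      (by simp [sdpCost]))
    rwa [canonicalForm_zero]
  · exact h.1.epsFeasible h0

/-- Makes (1) nonempty and hence, through the reduction, (2) as well. -/
theorem epsFeasible_zero (hε : 0 ≤ ε) : EpsFeasible g f d ε 0 :=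
  ⟨by simp, by simpa using C_mem_truncModule hε⟩

end

theorem sub_C_eval_eq (p : MvPolynomial (Fin n) ℝ) :
    p - C (eval 0 p) = ∑ i, C (p.coeff (Finsupp.single i 1)) * X i +
      ∑ α ∈ p.support with 2 ≤ α.degree, monomial α (p.coeff α) := by
  classical
  have e0 : eval 0 p = p.coeff 0 := by
    rw [← constantCoeff_eq, constantCoeff_eq, ← MvPolynomial.coe_aeval_eq_eval]
    simp [constantCoeff_eq]
  ext α
  rw [e0, coeff_add, coeff_sum_C_mul_X, coeff_sub, coeff_C, coeff_sum]
  simp only [coeff_monomial, Finset.sum_ite_eq', Finset.mem_filter, mem_support_iff]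
  rcases Nat.lt_or_ge α.degree 2 with h | h
  · have hn : ¬(coeff α p ≠ 0 ∧ 2 ≤ α.degree) := fun h' => by omega
    rw [if_neg hn, add_zero]
    by_cases h0 : α = 0
    · subst h0
      simp
    · have h1 : α.degree = 1 := by
        have : α.degree ≠ 0 := fun h => h0 ((Finsupp.degree_eq_zero_iff α).1 h)
        omega
      obtain ⟨i, rfl⟩ : α ∈ Set.range (fun i : Fin n => Finsupp.single i 1) := by
        rw [Finsupp.range_single_one]
        exact h1
      simp [Finsupp.single_eq_single_iff, Ne.symm h0]
  · have h0 : (0 : Fin n →₀ ℕ) ≠ α := by rintro rfl; simp at h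
    have h1 : ∀ i : Fin n, Finsupp.single i 1 ≠ α := by
      rintro i rfl; simp at h
    simp [h0, h1, h]

theorem EpsFeasible.exists_sdpFeasible {m : ℕ} {g : Fin m → MvPolynomial (Fin n) ℝ}
    {f h : MvPolynomial (Fin n) ℝ} {d : ℕ} {ε : ℝ} (hd : f.totalDegree ≤ 2 * d)
    (hh : EpsFeasible (withBox g) f d ε h) :
    ∃ b c, SDPFeasible (withBox g) f d ε b c ∧ sdpCost b c ≤ coeffNorm1 (f - h) := by
  classical
  set q := h - f with hq
  set s := q.support.filter (fun α => 2 ≤ α.degree) with hs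
  have hqd : q.totalDegree ≤ f.totalDegree := (totalDegree_sub h f).trans (max_le hh.1 le_rfl)
  have hsd : ∀ α ∈ s, 2 ≤ α.degree ∧ α.degree ≤ f.totalDegree := fun α hα => by
    rw [hs, Finset.mem_filter] at hα
    exact ⟨hα.2, (le_totalDegree hα.1).trans hqd⟩
  -- The sign is negative so that adding these elements to the certificate of `h` removes the terms
  -- of `q` of degree at least 2.
  have hw : ∀ α : s, ∃ w : Fin n → ℝ, (∀ i, 0 ≤ w i) ∧ ∑ i, w i = |q.coeff α| ∧
      ∑ i, C (w i) * X i ^ 2 + monomial α.1 (-q.coeff α) ∈ truncModule (withBox g) d :=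
    fun α => by
      simpa using exists_weights (g := g) (d := d) α.1 (hsd α.1 α.2).1
        ((hsd α.1 α.2).2.trans hd) (-q.coeff α)
  choose w hw0 hw1 hw2 using hw
  refine ⟨fun i => q.coeff (Finsupp.single i 1), fun i => ∑ α, w α i, ⟨?_, ?_, ?_⟩, ?_⟩
  · have key := truncModule_add hh.2 (truncModule_sum Finset.univ fun α _ => hw2 α)
    convert key using 1
    have e1 := sub_C_eval_eq q
    rw [← hs, ← Finset.sum_coe_sort s] at e1
    have e2 : ∑ i, C (∑ α, w α i) * (X i : MvPolynomial (Fin n) ℝ) ^ 2 =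
        ∑ α, ∑ i, C (w α i) * X i ^ 2 := by
      rw [Finset.sum_comm]
      simp only [map_sum, Finset.sum_mul]
    simp only [Finset.sum_add_distrib, map_neg, Finset.sum_neg_distrib]
    rw [e2]
    have e3 : eval 0 q = eval 0 h - eval 0 f := by simp [hq]
    rw [e3, C_sub] at e1
    have e4 : h = f + q := by rw [hq]; ring
    linear_combination e4 - e1
  · exact fun i => Finset.sum_nonneg fun α _ => hw0 α i
  · intro h1
    funext i
    refine Finset.sum_eq_zero fun α _ => ?_
    have := hsd α.1 α.2
    omega
  · have e : coeffNorm1 (f - h) = coeffNorm1 q := by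
      have : f - h = -q := by rw [hq]; ring
      simp [coeffNorm1, this]
    -- Linear exponents and `s` use disjoint sets of coefficients of `q`. The constant coefficient
    -- is dropped, hence only an inequality of costs.
    have hdisj : Disjoint (Finset.univ.image fun i : Fin n => Finsupp.single i 1) s := by
      rw [Finset.disjoint_left]
      intro α hα hα'
      obtain ⟨i, -, rfl⟩ := Finset.mem_image.1 hα
      have := (hsd _ hα').1
      simp at this
    have hle := sum_abs_coeff_le_coeffNorm1 q
      ((Finset.univ.image fun i : Fin n => Finsupp.single i 1) ∪ s)
    rw [Finset.sum_union hdisj, Finset.sum_image (fun i _ j _ hij =>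
      Finsupp.single_left_injective one_ne_zero hij)] at hle
    rw [e, sdpCost, Finset.sum_comm]
    simp only [hw1]
    rw [Finset.sum_coe_sort s (fun α => |q.coeff α|)]
    exact hle

end InversePoly

/-! ### Gram parametrization and closedness of the truncated quadratic module. -/

namespace InversePoly

open MvPolynomial Filter Topology
open scoped MonomialOrder

variable {n : ℕ}

/-- Leading terms with nonnegative coefficients cannot cancel. The order `degLex` is used because it
refines total degree. -/
theorem degLex_degree_le_add {a s : MvPolynomial (Fin n) ℝ}
    (ha : 0 ≤ MonomialOrder.degLex.leadingCoeff a) (hs : 0 ≤ MonomialOrder.degLex.leadingCoeff s) :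
    MonomialOrder.degLex.degree a ≼[MonomialOrder.degLex] MonomialOrder.degLex.degree (a + s) ∧
      0 ≤ MonomialOrder.degLex.leadingCoeff (a + s) := by
  set m : MonomialOrder (Fin n) := MonomialOrder.degLex
  rcases lt_trichotomy (m.toSyn (m.degree a)) (m.toSyn (m.degree s)) with h | h | h
  · rw [m.degree_add_eq_right_of_lt h, add_comm, m.leadingCoeff_add_of_lt h]
    exact ⟨h.le, hs⟩
  · by_cases ha0 : a = 0
    · subst ha0
      simpa using hs
    by_cases hs0 : s = 0
    · subst hs0
      simpa using ha
    have hd : m.degree a = m.degree s := m.toSyn.injective h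
    have ha' : 0 < m.leadingCoeff a := ha.lt_of_ne' (m.leadingCoeff_ne_zero_iff.2 ha0)
    have hpos : 0 < coeff (m.degree a) (a + s) := by
      rw [coeff_add]
      nth_rewrite 2 [hd]
      exact add_pos_of_pos_of_nonneg ha' hs
    have h1 : m.toSyn (m.degree a) ≤ m.toSyn (m.degree (a + s)) :=
      m.le_degree (mem_support_iff.2 hpos.ne')
    have h2 : m.toSyn (m.degree (a + s)) ≤ m.toSyn (m.degree a) := by
      simpa [← hd] using m.degree_add_le (f := a) (g := s)
    refine ⟨h1, ?_⟩
    rw [MonomialOrder.leadingCoeff, m.toSyn.injective (le_antisymm h2 h1)]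
    exact hpos.le
  · rw [m.degree_add_of_lt h, m.leadingCoeff_add_of_lt h]
    exact ⟨le_rfl, ha⟩

theorem degLex_leadingCoeff_mul_self_nonneg (a : MvPolynomial (Fin n) ℝ) :
    0 ≤ MonomialOrder.degLex.leadingCoeff (a * a) := by
  rw [MonomialOrder.leadingCoeff_mul]
  exact mul_self_nonneg _

theorem IsSumSq.degLex_leadingCoeff_nonneg {p : MvPolynomial (Fin n) ℝ} (hp : IsSumSq p) :
    0 ≤ MonomialOrder.degLex.leadingCoeff p := by
  induction hp with
  | zero => simp
  | sq_add a hs ih => exact (degLex_degree_le_add (degLex_leadingCoeff_mul_self_nonneg a) ih).2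

/-- `sosLE` bounds only the degree of the whole sum; this passes the bound to each square. -/
theorem totalDegree_le_totalDegree_sq_add (a : MvPolynomial (Fin n) ℝ)
    {s : MvPolynomial (Fin n) ℝ} (hs : IsSumSq s) :
    2 * a.totalDegree ≤ (a * a + s).totalDegree ∧ s.totalDegree ≤ (a * a + s).totalDegree := by
  have ha := degLex_leadingCoeff_mul_self_nonneg a
  have hs := IsSumSq.degLex_leadingCoeff_nonneg hs
  refine ⟨?_, ?_⟩
  · have h := degLex_totalDegree_monotone (degLex_degree_le_add ha hs).1
    by_cases h0 : a = 0
    · simp [h0]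
    · rw [totalDegree_mul_of_isDomain h0 h0] at h
      omega
  · rw [add_comm]
    exact degLex_totalDegree_monotone (degLex_degree_le_add hs ha).1

/-- The sum of the squares of the polynomials whose coefficients, at the exponents in `S`, are the
rows of `B`. -/
noncomputable def gramSq (S : Finset (Fin n →₀ ℕ)) (B : S → S → ℝ) : MvPolynomial (Fin n) ℝ :=
  ∑ l, (∑ β : S, monomial β.1 (B l β)) ^ 2

theorem gramSq_eq (S : Finset (Fin n →₀ ℕ)) (B : S → S → ℝ) :
    gramSq S B = ∑ β : S, ∑ γ : S, monomial (β.1 + γ.1) (∑ l, B l β * B l γ) := by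
  simp only [gramSq, sq, Finset.sum_mul_sum, monomial_mul, map_sum]
  rw [Finset.sum_comm]
  exact Finset.sum_congr rfl fun β _ => Finset.sum_comm

theorem gramSq_smul (S : Finset (Fin n →₀ ℕ)) (t : ℝ) (B : S → S → ℝ) :
    gramSq S (t • B) = C (t ^ 2) * gramSq S B := by
  simp only [gramSq, Pi.smul_apply, smul_eq_mul, ← C_mul_monomial, ← Finset.mul_sum, mul_pow, C_pow]

theorem gramSq_zero (S : Finset (Fin n →₀ ℕ)) : gramSq S 0 = 0 := by
  simp [gramSq]

theorem isSumSq_gramSq (S : Finset (Fin n →₀ ℕ)) (B : S → S → ℝ) : IsSumSq (gramSq S B) :=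
  IsSumSq.sum fun l _ => by rw [sq]; exact IsSumSq.mul_self _

open scoped MatrixOrder in
-- The Gram matrix `v vᵀ + Bᵀ B` is positive semidefinite, so it factors as `Mᵀ M` with `M` square.
-- Thus `|S|` squares always suffice and the parameter space has a fixed finite dimension.
theorem exists_gramSq_add (S : Finset (Fin n →₀ ℕ)) {a : MvPolynomial (Fin n) ℝ}
    (ha : a.support ⊆ S) (B : S → S → ℝ) : ∃ B', a * a + gramSq S B = gramSq S B' := by
  classical
  set v : S → ℝ := fun β => a.coeff β.1
  have ha' : a = ∑ β : S, monomial β.1 (v β) := by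
    rw [Finset.sum_coe_sort S (fun β => monomial β (a.coeff β))]
    conv_lhs => rw [← support_sum_monomial_coeff a]
    exact Finset.sum_subset ha fun β _ h => by simp [notMem_support_iff.1 h]
  have hpsd : (Matrix.vecMulVec v (star v) + (Matrix.of B).conjTranspose * Matrix.of B).PosSemidef :=
    (Matrix.posSemidef_vecMulVec_self_star v).add (Matrix.posSemidef_conjTranspose_mul_self _)
  obtain ⟨M, hM⟩ := CStarAlgebra.nonneg_iff_eq_star_mul_self.mp hpsd.nonneg
  refine ⟨fun l β => M l β, ?_⟩
  rw [gramSq_eq, gramSq_eq, ha', Finset.sum_mul_sum, ← Finset.sum_add_distrib]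
  refine Finset.sum_congr rfl fun β _ => ?_
  rw [← Finset.sum_add_distrib]
  refine Finset.sum_congr rfl fun γ _ => ?_
  rw [monomial_mul, ← map_add]
  congr 1
  have := congrFun (congrFun hM β) γ
  simpa [Matrix.mul_apply, Matrix.vecMulVec_apply] using this

/-- The exponents of degree at most `k`. -/
noncomputable def exponentsLE (n : ℕ) (k : ℤ) : Finset (Fin n →₀ ℕ) :=
  (Set.Finite.subset (Finsupp.finite_of_degree_le k.toNat)
    (t := {β : Fin n →₀ ℕ | (β.degree : ℤ) ≤ k}) fun β (hβ : (β.degree : ℤ) ≤ k) =>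
      show β.degree ≤ k.toNat by omega).toFinset

theorem mem_exponentsLE {k : ℤ} {β : Fin n →₀ ℕ} :
    β ∈ exponentsLE n k ↔ (β.degree : ℤ) ≤ k := by
  simp [exponentsLE]

theorem mem_sosLE_iff_gramSq {k : ℤ} {p : MvPolynomial (Fin n) ℝ} :
    p ∈ sosLE n k ↔ ∃ B, p = gramSq (exponentsLE n k) B := by
  constructor
  · rintro ⟨hp, hk⟩
    induction hp with
    | zero => exact ⟨0, (gramSq_zero _).symm⟩
    | @sq_add a s hs ih =>
      rcases hk with h0 | hk
      · exact ⟨0, by rw [h0, gramSq_zero]⟩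
      obtain ⟨h1, h2⟩ := totalDegree_le_totalDegree_sq_add a hs
      obtain ⟨B, rfl⟩ := ih (Or.inr (by omega))
      refine exists_gramSq_add _ (fun β hβ => mem_exponentsLE.2 ?_) B
      have : β.degree ≤ a.totalDegree := le_totalDegree hβ
      omega
  · rintro ⟨B, rfl⟩
    refine ⟨isSumSq_gramSq _ B, ?_⟩
    by_cases hk : 0 ≤ k
    · right
      have : (gramSq (exponentsLE n k) B).totalDegree ≤ 2 * k.toNat :=
        totalDegree_finsetSum_le fun l _ => (totalDegree_pow _ _).trans
          (Nat.mul_le_mul_left _ (totalDegree_finsetSum_le fun β _ =>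
            (totalDegree_monomial_le _ _).trans (by
              have : (β.1.degree : ℤ) ≤ k := mem_exponentsLE.1 β.2
              have e : (β.1.sum fun _ => id) = β.1.degree := rfl
              omega)))
      omega
    · left
      -- For negative `k` there is no exponent, and the empty Gram sum is 0.
      have he : exponentsLE n k = ∅ := Finset.eq_empty_of_forall_notMem fun β hβ => by
        have := mem_exponentsLE.1 hβ
        omega
      have : IsEmpty (exponentsLE n k) := by rw [he]; infer_instance
      simp [gramSq]

theorem eval_gramSq (S : Finset (Fin n →₀ ℕ)) (B : S → S → ℝ) (x : Fin n → ℝ) :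
    eval x (gramSq S B) = ∑ l, (eval x (∑ β : S, monomial β.1 (B l β))) ^ 2 := by
  simp only [gramSq, map_sum, map_pow]

/-- A ball for the sup norm is a product of infinite sets, and a polynomial vanishing on such a
product is 0. -/
theorem eq_zero_of_eval_eq_zero_on_interior {K : Set (Fin n → ℝ)} (hK : (interior K).Nonempty)
    {p : MvPolynomial (Fin n) ℝ} (hp : ∀ x ∈ K, eval x p = 0) : p = 0 := by
  obtain ⟨x, hx⟩ := hK
  obtain ⟨δ, hδ, hball⟩ := Metric.isOpen_iff.1 isOpen_interior x hx
  refine funext_set (fun i => Metric.ball (x i) δ) (fun i => ?_) fun y hy => ?_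
  · rw [Real.ball_eq_Ioo]
    exact Set.Ioo_infinite (by linarith)
  · rw [map_zero]
    refine hp y (interior_subset (hball ?_))
    rwa [ball_pi x hδ]

section GramSum

variable {J : Type} [Fintype J] (S : J → Finset (Fin n →₀ ℕ)) (g : J → MvPolynomial (Fin n) ℝ)

/-- The element `∑ j, σ_j g_j` with multipliers `σ_j` given by their Gram factors. -/
noncomputable def gramSum (B : (j : J) → S j → S j → ℝ) : MvPolynomial (Fin n) ℝ :=
  ∑ j, gramSq (S j) (B j) * g j

theorem gramSum_smul (t : ℝ) (B : (j : J) → S j → S j → ℝ) :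
    gramSum S g (t • B) = C (t ^ 2) * gramSum S g B := by
  simp only [gramSum, Pi.smul_apply, gramSq_smul, Finset.mul_sum, mul_assoc]

theorem continuous_coeff_gramSum (α : Fin n →₀ ℕ) :
    Continuous fun B : (j : J) → S j → S j → ℝ => coeff α (gramSum S g B) := by
  have h : ∀ (β : Fin n →₀ ℕ) (r : ℝ) (q : MvPolynomial (Fin n) ℝ),
      coeff α (monomial β r * q) = r * coeff α (monomial β 1 * q) := fun β r q => by
    rw [← coeff_C_mul, ← mul_assoc, C_mul_monomial, mul_one]
  simp only [gramSum, gramSq_eq, Finset.sum_mul, coeff_sum]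
  refine continuous_finsetSum _ fun j _ => continuous_finsetSum _ fun β _ =>
    continuous_finsetSum _ fun γ _ => ?_
  simp only [h _ (∑ l, _)]
  fun_prop

variable {S g}

/-- On `K` all summands are nonnegative with sum 0, so each vanishes there, hence identically.
Cancelling `g j` leaves a vanishing sum of squares, so every square and every entry of `B` is 0. -/
theorem gramSum_eq_zero {K : Set (Fin n → ℝ)} (hK : (interior K).Nonempty)
    (hg : ∀ j, ∀ x ∈ K, 0 ≤ eval x (g j)) (hS : ∀ j, (S j).Nonempty → g j ≠ 0)
    {B : (j : J) → S j → S j → ℝ} (hB : gramSum S g B = 0) : B = 0 := by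
  funext j l β
  have hgj : g j ≠ 0 := hS j ⟨l.1, l.2⟩
  have hnn : ∀ j x, 0 ≤ eval x (gramSq (S j) (B j)) := fun j x => by
    rw [eval_gramSq]
    exact Finset.sum_nonneg fun _ _ => sq_nonneg _
  have h1 : gramSq (S j) (B j) * g j = 0 := by
    refine eq_zero_of_eval_eq_zero_on_interior hK fun x hx => ?_
    have h := congrArg (eval x) hB
    rw [gramSum, map_sum, map_zero] at h
    refine (Finset.sum_eq_zero_iff_of_nonneg fun i _ => ?_).1 h j (Finset.mem_univ j)
    rw [map_mul]
    exact mul_nonneg (hnn i x) (hg i x hx)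
  have h2 : gramSq (S j) (B j) = 0 := (mul_eq_zero.1 h1).resolve_right hgj
  have h3 : ∑ β : S j, monomial β.1 (B j l β) = 0 := by
    refine MvPolynomial.funext fun x => ?_
    have h := congrArg (eval x) h2
    rw [eval_gramSq, map_zero] at h
    rw [map_zero]
    exact pow_eq_zero_iff two_ne_zero |>.1
      ((Finset.sum_eq_zero_iff_of_nonneg fun _ _ => sq_nonneg _).1 h l (Finset.mem_univ l))
  have h4 := congrArg (coeff β.1) h3
  simpa [coeff_sum, coeff_monomial, Subtype.coe_inj] using h4

end GramSum

/-- A continuous map on a finite-dimensional space which is homogeneous of degree `2` and vanishes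
only at the origin has closed range. -/
theorem isClosed_range_of_homogeneous {V Y : Type*} [NormedAddCommGroup V] [NormedSpace ℝ V]
    [ProperSpace V] [AddCommGroup Y] [Module ℝ Y] [TopologicalSpace Y] [ContinuousSMul ℝ Y]
    [T2Space Y] [FrechetUrysohnSpace Y] {Φ : V → Y} (hc : Continuous Φ)
    (hh : ∀ (t : ℝ) v, Φ (t • v) = t ^ 2 • Φ v) (h0 : ∀ v, Φ v = 0 → v = 0) :
    IsClosed (Set.range Φ) := by
  refine isClosed_of_closure_subset fun y hy => ?_
  obtain ⟨x, hx, hxy⟩ := mem_closure_iff_seq_limit.1 hy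
  choose v hv using hx
  obtain rfl : x = Φ ∘ v := funext fun k => (hv k).symm
  by_cases hb : Tendsto (fun k => ‖v k‖) atTop atTop
  -- If the norms tend to infinity, the normalized vectors accumulate at a unit vector `u`, while by
  -- homogeneity their images are `Φ (v k) / ‖v k‖² → 0`. So `Φ u = 0`, which is impossible.
  · exfalso
    have hev : ∀ᶠ k in atTop, ‖v k‖ ≠ 0 := hb.eventually_ne_atTop 0
    have hs : ∃ᶠ k in atTop, ‖v k‖⁻¹ • v k ∈ Metric.sphere (0 : V) 1 :=
      (hev.mono fun k hk => by
        rw [mem_sphere_zero_iff_norm, norm_smul, norm_inv, norm_norm, inv_mul_cancel₀ hk]).frequently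
    obtain ⟨u, hu, φ, hφ, hlim⟩ := tendsto_subseq_of_frequently_bounded
      Metric.isBounded_sphere hs
    rw [Metric.isClosed_sphere.closure_eq, mem_sphere_zero_iff_norm] at hu
    have h1 : Tendsto (fun k => Φ (‖v (φ k)‖⁻¹ • v (φ k))) atTop (𝓝 (Φ u)) :=
      (hc.tendsto u).comp hlim
    have h2 : Tendsto (fun k => Φ (‖v (φ k)‖⁻¹ • v (φ k))) atTop (𝓝 0) := by
      simp only [hh]
      have h3 : Tendsto (fun k => ‖v (φ k)‖⁻¹ ^ 2) atTop (𝓝 0) := by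
        simpa using (tendsto_inv_atTop_zero.comp (hb.comp hφ.tendsto_atTop)).pow 2
      simpa using h3.smul (hxy.comp hφ.tendsto_atTop)
    rw [h0 u (tendsto_nhds_unique h1 h2), norm_zero] at hu
    exact zero_ne_one hu
  -- Otherwise infinitely many `v k` lie in one ball, which is enough for a convergent subsequence.
  · obtain ⟨M, hM⟩ : ∃ M, ∃ᶠ k in atTop, ‖v k‖ < M := by
      rw [tendsto_atTop] at hb
      push Not at hb
      obtain ⟨M, hM⟩ := hb
      exact ⟨M, hM.mono fun k hk => by simpa using hk⟩
    obtain ⟨u, -, φ, hφ, hlim⟩ := tendsto_subseq_of_frequently_bounded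
      (Metric.isBounded_ball (x := (0 : V)) (r := M))
      (hM.mono fun k hk => by simpa using hk)
    exact ⟨u, tendsto_nhds_unique ((hc.tendsto u).comp hlim) (hxy.comp hφ.tendsto_atTop)⟩

/-- Limits are taken in the product topology on coefficient families; the exponents are countable,
so sequences detect closures. -/
theorem isClosed_range_coeff_gramSum {J : Type} [Fintype J] {S : J → Finset (Fin n →₀ ℕ)}
    {g : J → MvPolynomial (Fin n) ℝ} {K : Set (Fin n → ℝ)} (hK : (interior K).Nonempty)
    (hg : ∀ j, ∀ x ∈ K, 0 ≤ eval x (g j)) (hS : ∀ j, (S j).Nonempty → g j ≠ 0) :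
    IsClosed (Set.range fun (B : (j : J) → S j → S j → ℝ) (α : Fin n →₀ ℕ) =>
      coeff α (gramSum S g B)) := by
  refine isClosed_range_of_homogeneous (continuous_pi fun α => continuous_coeff_gramSum S g α)
    (fun t B => ?_) fun B hB => gramSum_eq_zero hK hg hS (MvPolynomial.ext _ _ fun α => ?_)
  · funext α
    rw [gramSum_smul, coeff_C_mul]
    rfl
  · simpa using congrFun hB α

/-- Treats `σ₀` as the multiplier of `g_0 = 1`, so that all multipliers are handled alike. -/
theorem mem_truncModule_iff {ι : Type} [Fintype ι] {g : ι → MvPolynomial (Fin n) ℝ} {d : ℕ}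
    {p : MvPolynomial (Fin n) ℝ} :
    p ∈ truncModule g d ↔ ∃ σ : Option ι → MvPolynomial (Fin n) ℝ,
      (∀ j, σ j ∈ sosLE n ((d : ℤ) - halfDeg (j.elim 1 g))) ∧ p = ∑ j, σ j * j.elim 1 g := by
  have h1 : halfDeg (1 : MvPolynomial (Fin n) ℝ) = 0 := by simp [halfDeg]
  constructor
  · rintro ⟨s, hs, σ, hσ, rfl⟩
    refine ⟨fun j => j.elim s σ, ?_, by simp [Fintype.sum_option]⟩
    rintro (_ | j)
    · simpa [h1] using hs
    · exact hσ j
  · rintro ⟨σ, hσ, rfl⟩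
    exact ⟨σ none, by simpa [h1] using hσ none, fun j => σ (some j), fun j => hσ (some j),
      by simp [Fintype.sum_option]⟩

theorem isClosed_coeff_truncModule {ι : Type} [Fintype ι] {g : ι → MvPolynomial (Fin n) ℝ}
    (hK : (interior (feasibleSet g)).Nonempty) (d : ℕ) :
    IsClosed ((fun (p : MvPolynomial (Fin n) ℝ) (α : Fin n →₀ ℕ) => coeff α p) ''
      truncModule g d) := by
  classical
  set G : Option ι → MvPolynomial (Fin n) ℝ := fun j => j.elim 1 g with hG
  -- If `G j = 0`, its multiplier does not affect the sum and would spoil triviality of the kernel.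
  -- Its block is made empty, which does not change the module.
  set S : Option ι → Finset (Fin n →₀ ℕ) := fun j =>
    if G j = 0 then ∅ else exponentsLE n ((d : ℤ) - halfDeg (G j)) with hS
  have hSpos : ∀ j, G j ≠ 0 → S j = exponentsLE n ((d : ℤ) - halfDeg (G j)) :=
    fun j h => if_neg h
  have key : truncModule g d = Set.range (gramSum S G) := by
    ext p
    rw [mem_truncModule_iff, Set.mem_range]
    constructor
    · rintro ⟨σ, hσ, rfl⟩
      have : ∀ j, ∃ B, gramSq (S j) B * G j = σ j * G j := fun j => by
        by_cases hj : G j = 0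
        · exact ⟨0, by rw [hj, mul_zero, mul_zero]⟩
        · rw [hSpos j hj]
          obtain ⟨B, hB⟩ := mem_sosLE_iff_gramSq.1 (hσ j)
          exact ⟨B, by rw [hB]⟩
      choose B hB using this
      exact ⟨B, Finset.sum_congr rfl fun j _ => hB j⟩
    · rintro ⟨B, rfl⟩
      refine ⟨fun j => if G j = 0 then 0 else gramSq (S j) (B j), fun j => ?_,
        Finset.sum_congr rfl fun j _ => ?_⟩
      · dsimp only
        split_ifs with hj
        · exact sosLE_zero_mem _
        · generalize B j = B'
          revert B'
          rw [hSpos j hj]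
          exact fun B' => mem_sosLE_iff_gramSq.2 ⟨B', rfl⟩
      · by_cases hj : G j = 0
        · rw [hj, mul_zero]
          change _ = _ * G j
          rw [hj, mul_zero]
        · simp only [hj, if_false]
          rfl
  rw [key, ← Set.range_comp]
  refine isClosed_range_coeff_gramSum hK (fun j x hx => ?_) fun j hj h0 => ?_
  · rcases j with _ | j
    · simp [hG]
    · exact hx j
  · simp [hS, h0] at hj

/-! ### Existence of a minimizer of the semidefinite program. -/

section Existence

variable {ι : Type} [Fintype ι] {g : ι → MvPolynomial (Fin n) ℝ}

theorem isClosed_sdpFeasible (hK : (interior (feasibleSet g)).Nonempty)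
    (f : MvPolynomial (Fin n) ℝ) (d : ℕ) (ε : ℝ) :
    IsClosed {z : (Fin n → ℝ) × (Fin n → ℝ) | SDPFeasible g f d ε z.1 z.2} := by
  have hinj : Function.Injective fun (p : MvPolynomial (Fin n) ℝ) (α : Fin n →₀ ℕ) => coeff α p :=
    fun p q h => MvPolynomial.ext _ _ fun α => congrFun h α
  have h1 : IsClosed {z : (Fin n → ℝ) × (Fin n → ℝ) |
      f - C (eval 0 f) + ∑ i, C (z.1 i) * X i + ∑ i, C (z.2 i) * X i ^ 2 + C ε ∈
        truncModule g d} := by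
    have hcont : Continuous fun (z : (Fin n → ℝ) × (Fin n → ℝ)) (α : Fin n →₀ ℕ) =>
        coeff α (f - C (eval 0 f) + ∑ i, C (z.1 i) * X i + ∑ i, C (z.2 i) * X i ^ 2 + C ε) := by
      refine continuous_pi fun α => ?_
      simp only [coeff_add, coeff_sum, coeff_C_mul]
      fun_prop
    convert (isClosed_coeff_truncModule hK d).preimage hcont using 1
    ext z
    exact (hinj.mem_set_image (s := truncModule g d)).symm
  have h2 : IsClosed {z : (Fin n → ℝ) × (Fin n → ℝ) | ∀ i, 0 ≤ z.2 i} := by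
    simp only [Set.ofPred_forall]
    exact isClosed_iInter fun i => isClosed_le continuous_const (by fun_prop)
  have h3 : IsClosed {z : (Fin n → ℝ) × (Fin n → ℝ) | f.totalDegree = 1 → z.2 = 0} := by
    by_cases h : f.totalDegree = 1
    · simpa [h] using isClosed_eq continuous_snd continuous_const
    · simp [h]
  exact h1.inter (h2.inter h3)

theorem norm_le_sdpCost {b c : Fin n → ℝ} (hc : ∀ i, 0 ≤ c i) : ‖(b, c)‖ ≤ sdpCost b c := by
  have hb' : 0 ≤ ∑ i, |b i| := Finset.sum_nonneg fun _ _ => abs_nonneg _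
  have hc' : 0 ≤ ∑ i, c i := Finset.sum_nonneg fun i _ => hc i
  have hb1 : ‖b‖ ≤ ∑ i, |b i| := (pi_norm_le_iff_of_nonneg hb').2 fun i =>
    Finset.single_le_sum (f := fun i => |b i|) (fun i _ => abs_nonneg _) (Finset.mem_univ i)
  have hc1 : ‖c‖ ≤ ∑ i, c i := (pi_norm_le_iff_of_nonneg hc').2 fun i => by
    rw [Real.norm_of_nonneg (hc i)]
    exact Finset.single_le_sum (f := c) (fun i _ => hc i) (Finset.mem_univ i)
  rw [sdpCost, Prod.norm_def]
  exact max_le (by linarith) (by linarith)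

/-- A continuous cost on a closed set attains its minimum once it exceeds the value at a feasible
point outside a compact set; `norm_le_sdpCost` supplies this coercivity. -/
theorem exists_sdpOptimal (hK : (interior (feasibleSet g)).Nonempty)
    {f : MvPolynomial (Fin n) ℝ} {d : ℕ} {ε : ℝ} (hne : ∃ b c, SDPFeasible g f d ε b c) :
    ∃ b c, SDPOptimal g f d ε b c := by
  obtain ⟨b₀, c₀, h₀⟩ := hne
  have hcont : Continuous fun z : (Fin n → ℝ) × (Fin n → ℝ) => sdpCost z.1 z.2 := by
    unfold sdpCost
    fun_prop
  have hev : ∀ᶠ z in cocompact ((Fin n → ℝ) × (Fin n → ℝ)) ⊓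
      𝓟 {z | SDPFeasible g f d ε z.1 z.2}, sdpCost b₀ c₀ ≤ sdpCost z.1 z.2 := by
    rw [eventually_inf_principal]
    filter_upwards [(tendsto_norm_cocompact_atTop).eventually_ge_atTop (sdpCost b₀ c₀)] with z hz hf
    exact hz.trans (norm_le_sdpCost hf.2.1)
  obtain ⟨z, hz, hmin⟩ := hcont.continuousOn.exists_isMinOn'
    (isClosed_sdpFeasible hK f d ε) (x₀ := (b₀, c₀)) h₀ hev
  exact ⟨z.1, z.2, hz, fun b c h => hmin (a := (b, c)) h⟩

end Existence

end InversePoly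

/-! ### Equivalence of optimality and conclusion. -/

theorem theorem4p3 {n m : ℕ} (g : Fin m → MvPolynomial (Fin n) ℝ)
    (f : MvPolynomial (Fin n) ℝ) (d : ℕ) (hd : f.totalDegree ≤ 2 * d)
    (h0 : (0 : Fin n → ℝ) ∈ InversePoly.feasibleSet (InversePoly.withBox g))
    (hint : (interior (InversePoly.feasibleSet (InversePoly.withBox g))).Nonempty)
    (ε : ℝ) (hε : 0 < ε) :
    -- both problems attain their minimum, and the two optimal values coincide
    (∃ ρ : ℝ,
      IsLeast {r | ∃ h, InversePoly.EpsFeasible (InversePoly.withBox g) f d ε h ∧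
        r = InversePoly.coeffNorm1 (f - h)} ρ ∧
      IsLeast {r | ∃ b c, InversePoly.SDPFeasible (InversePoly.withBox g) f d ε b c ∧
        r = InversePoly.sdpCost b c} ρ) ∧
    -- some optimal solution has the canonical form, given by an optimal solution of the program
    (∃ b c : Fin n → ℝ, (∀ i, 0 ≤ c i) ∧ (f.totalDegree = 1 → c = 0) ∧
      InversePoly.SDPOptimal (InversePoly.withBox g) f d ε b c ∧
      InversePoly.EpsOptimal (InversePoly.withBox g) f d ε (InversePoly.canonicalForm f b c)) ∧
    -- the optimal solutions of canonical form are exactly those given by the program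
    (∀ b c : Fin n → ℝ, (∀ i, 0 ≤ c i) →
      (InversePoly.EpsOptimal (InversePoly.withBox g) f d ε (InversePoly.canonicalForm f b c) ↔
        InversePoly.SDPOptimal (InversePoly.withBox g) f d ε b c)) := by
  open InversePoly in
  have hiff : ∀ b c : Fin n → ℝ, (∀ i, 0 ≤ c i) →
      (EpsOptimal (withBox g) f d ε (canonicalForm f b c) ↔
        SDPOptimal (withBox g) f d ε b c) := by
    intro b c hc
    constructor
    · intro h
      refine ⟨h.1.sdpFeasible hc, fun b' c' h' => ?_⟩
      -- The competitor is not always `canonicalForm f b' c'`, which may be infeasible for constant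
      -- `f`.
      obtain ⟨p, hp, hle⟩ := h'.exists_epsFeasible hε.le
      rw [← coeffNorm1_sub_canonicalForm_of_nonneg f b hc]
      exact (h.2 p hp).trans hle
    · intro h
      refine ⟨h.epsFeasible hε.le, fun p hp => ?_⟩
      obtain ⟨b', c', h', hle⟩ := hp.exists_sdpFeasible hd
      rw [coeffNorm1_sub_canonicalForm_of_nonneg f b hc]
      exact (h.2 b' c' h').trans hle
  obtain ⟨b₁, c₁, h₁, -⟩ :=
    (InversePoly.epsFeasible_zero (g := InversePoly.withBox g) (f := f) (d := d)
      hε.le).exists_sdpFeasible hd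
  obtain ⟨b, c, hbc⟩ := InversePoly.exists_sdpOptimal hint ⟨b₁, c₁, h₁⟩
  have hc := hbc.1.2.1
  have hopt := (hiff b c hc).2 hbc
  refine ⟨⟨InversePoly.sdpCost b c, ⟨?_, ?_⟩, ⟨b, c, hbc.1, rfl⟩, ?_⟩,
    ⟨b, c, hc, hbc.1.2.2, hbc, hopt⟩, hiff⟩
  · exact ⟨_, hopt.1, (InversePoly.coeffNorm1_sub_canonicalForm_of_nonneg f b hc).symm⟩
  · rintro r ⟨p, hp, rfl⟩
    rw [← InversePoly.coeffNorm1_sub_canonicalForm_of_nonneg f b hc]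
    exact hopt.2 p hp
  · rintro r ⟨b', c', h', rfl⟩
    exact hbc.2 b' c' h'
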